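/- Let $R$ be an associative ring with unit that is not right perfect (that is, not every right $R$-module has a projective cover). For an infinite regular cardinal $\lambda$, a monomorphism $f\colon B\to A$ of right $R$-modules is called $\lambda$-pure if for every right $R$-module $C$ which has a presentation with fewer than $\lambda$ generators and fewer than $\lambda$ relations, the map $\operatorname{Hom}_R(C,A)\to\operatorname{Hom}_R(C,\operatorname{Coker} f)$ induced by the canonical projection is surjective; pure means $\aleph_0$-pure. A right $R$-module $N$ is $\lambda$-pure-injective if $\operatorname{Hom}_R(f,N)\colon\operatorname{Hom}_R(A,N)\to\operatorname{Hom}_R(B,N)$ is surjective for every $\lambda$-pure monomorphism $f\colon B\to A$ of right $R$-modules. Then: (1) $\mathrm{Mod}\text{-}R$ does not have enough $\aleph_1$-pure-injective objects, i.e. it is not true that every right $R$-module admits an $\aleph_1$-pure monomorphism into an $\aleph_1$-pure-injective right $R$-module. (2) There exists a monomorphism $\nu$ of right $R$-modules which is pure but not $\aleph_1$-pure, such that $\operatorname{Hom}_R(\nu,N)$ is surjective for every $\aleph_1$-pure-injective right $R$-module $N$. -/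

import Mathlib

universe u

/-! Right modules over `R` are modules over the opposite ring `Rᵐᵒᵖ`. The notions below are written
for modules over a ring `S` and are used with `S = Rᵐᵒᵖ`. -/

/-- A submodule `K` of `P` is superfluous if `U + K = P` only for `U = P`. -/
def IsSuperfluousSubmodule {S : Type u} [Ring S] {P : Type u} [AddCommGroup P] [Module S P]
    (K : Submodule S P) : Prop :=
  ∀ U : Submodule S P, U ⊔ K = ⊤ → U = ⊤

/-- `M` has a projective cover: an epimorphism from a projective module onto `M` whose kernel is
superfluous. -/
def HasProjectiveCover (S : Type u) [Ring S] (M : Type u) [AddCommGroup M] [Module S M] : Prop :=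
  ∃ (P : Type u) (_ : AddCommGroup P) (_ : Module S P) (p : P →ₗ[S] M),
    Module.Projective S P ∧ Function.Surjective p ∧ IsSuperfluousSubmodule (LinearMap.ker p)

/-- A ring is right perfect if each of its right modules has a projective cover. -/
def IsRightPerfect (R : Type u) [Ring R] : Prop :=
  ∀ (M : Type u) [AddCommGroup M] [Module Rᵐᵒᵖ M], HasProjectiveCover Rᵐᵒᵖ M

/-- `C` is `< κ`-presented: it has a presentation by fewer than `κ` generators and fewer than `κ`
relations. -/
def IsLTPresented (κ : Cardinal.{u}) (S : Type u) [Ring S] (C : Type u) [AddCommGroup C]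
    [Module S C] : Prop :=
  ∃ (ι : Type u) (p : (ι →₀ S) →ₗ[S] C) (rels : Set (ι →₀ S)),
    Cardinal.mk ι < κ ∧ Function.Surjective p ∧ Cardinal.mk rels < κ ∧
      Submodule.span S rels = LinearMap.ker p

/-- `f : B → A` is a `κ`-pure monomorphism: it is injective, and for each `< κ`-presented module `C`
the map `Hom(C, A) → Hom(C, Coker f)` induced by the canonical projection is surjective.
For `κ = ℵ₀` this is a pure monomorphism. -/
def IsPureMono (κ : Cardinal.{u}) {S : Type u} [Ring S] {B A : Type u} [AddCommGroup B]
    [Module S B] [AddCommGroup A] [Module S A] (f : B →ₗ[S] A) : Prop :=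
  Function.Injective f ∧
    ∀ (C : Type u) [AddCommGroup C] [Module S C], IsLTPresented κ S C →
      ∀ h : C →ₗ[S] A ⧸ LinearMap.range f, ∃ g : C →ₗ[S] A, (LinearMap.range f).mkQ ∘ₗ g = h

/-- `Hom(f, N) : Hom(A, N) → Hom(B, N)` is surjective, for `f : B → A`. -/
def HomSurjective {S : Type u} [Ring S] {B A : Type u} [AddCommGroup B] [Module S B]
    [AddCommGroup A] [Module S A] (f : B →ₗ[S] A) (N : Type u) [AddCommGroup N]
    [Module S N] : Prop :=
  ∀ h : B →ₗ[S] N, ∃ g : A →ₗ[S] N, g ∘ₗ f = h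

/-- `N` is `κ`-pure-injective: injective with respect to all `κ`-pure monomorphisms. -/
def IsPureInjective (κ : Cardinal.{u}) (S : Type u) [Ring S] (N : Type u) [AddCommGroup N]
    [Module S N] : Prop :=
  ∀ (B A : Type u) [AddCommGroup B] [Module S B] [AddCommGroup A] [Module S A] (f : B →ₗ[S] A),
    IsPureMono κ f → HomSurjective f N

/-- The category of `S`-modules has enough `κ`-pure-injective objects: each module admits a
`κ`-pure monomorphism into a `κ`-pure-injective module. -/
def HasEnoughPureInjectives (κ : Cardinal.{u}) (S : Type u) [Ring S] : Prop :=
  ∀ (B : Type u) [AddCommGroup B] [Module S B],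
    ∃ (N : Type u) (_ : AddCommGroup N) (_ : Module S N) (f : B →ₗ[S] N),
      IsPureInjective κ S N ∧ IsPureMono κ f

/-! If every chain of principal left ideals stops, `R` is right perfect (Bass). So for `R` not right
perfect some chain `x (n + 1) = b n * x n` never stops, and `ν` is `bassMap` of its multipliers. It
is pure, being injective with finitely many relations correctable at a time (`isPureMono_bassMap`).
Its cokernel is countably presented, so if it were `ℵ₁`-pure it would split, and a retraction stops
the chain (`exists_eq_mul_of_bassMap_retraction`).

Every `ℵ₁`-pure-injective `N` is nevertheless injective for `ν`. Glue copies of `ν`, one for each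
branch of the tree of finite sequences in `κ`, along the nodes: `treeMap` is `ℵ₁`-pure, since
countably many branches have disjoint tails. If some `h` did not extend along `ν`, prescribing `h`
on a set of branches and `0` elsewhere would give extensions along `treeMap` that differ on nodes
for different sets. That is too many maps from the nodes to `N` when `|N| ≤ κ` and `2 ^ κ ≤ κ ^ ℵ₀`.

Part (1) follows: an `ℵ₁`-pure map into such an `N` would factor through `ν` and make `ν` `ℵ₁`-pure.
-/

/-- The descending chain condition on principal left ideals, in terms of their generators. -/
def HasPrincipalLeftDCC (R : Type*) [Ring R] : Prop :=
  ∀ x b : ℕ → R, (∀ n, x (n + 1) = b n * x n) → ∃ n s, x n = s * x (n + 1)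

/-- A form of T-nilpotence of a left ideal: multiplying successively by elements of `I` on the
right one arrives at zero. -/
def Ideal.IsTNilpotent {S : Type*} [Ring S] (I : Ideal S) : Prop :=
  ∀ x a : ℕ → S, (∀ n, a n ∈ I) → (∀ n, x (n + 1) = x n * a n) → ∃ n, x n = 0

/-! ### Descending chains of principal left ideals and semisimplicity -/

section Chain

variable {R Q : Type*} [Ring R] [Ring Q]

theorem HasPrincipalLeftDCC.of_surjective (h : HasPrincipalLeftDCC R) (f : R →+* Q)
    (hf : Function.Surjective f) : HasPrincipalLeftDCC Q := by
  intro x b hx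
  choose g hg using hf
  let y : ℕ → R := fun n => Nat.rec (g (x 0)) (fun n y => g (b n) * y) n
  have hy : ∀ n, f (y n) = x n := by
    intro n
    induction n with
    | zero => exact hg _
    | succ n ih =>
      change f (g (b n) * y n) = _
      rw [map_mul, hg, ih, hx]
  obtain ⟨n, s, hs⟩ := h y (fun n => g (b n)) (fun n => rfl)
  exact ⟨n, f s, by rw [← hy, ← hy, hs, map_mul]⟩

theorem HasPrincipalLeftDCC.wellFounded (h : HasPrincipalLeftDCC R) :
    WellFounded fun x y : R => x ∈ Ideal.span {y} ∧ y ∉ Ideal.span {x} := by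
  rw [wellFounded_iff_isEmpty_descending_chain]
  refine ⟨fun ⟨x, hx⟩ => ?_⟩
  choose b hb using fun n => Ideal.mem_span_singleton'.1 (hx n).1
  obtain ⟨n, s, hs⟩ := h x b fun n => (hb n).symm
  exact (hx n).2 (Ideal.mem_span_singleton'.2 ⟨s, hs.symm⟩)

theorem HasPrincipalLeftDCC.exists_isAtom_le (h : HasPrincipalLeftDCC R) {A : Ideal R}
    (hA : A ≠ ⊥) : ∃ T : Ideal R, IsAtom T ∧ T ≤ A := by
  obtain ⟨a, haA, ha⟩ := Submodule.exists_mem_ne_zero_of_ne_bot hA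
  obtain ⟨x, ⟨hxA, hx⟩, hmin⟩ := h.wellFounded.has_min {x | x ∈ A ∧ x ≠ 0} ⟨a, haA, ha⟩
  refine ⟨Ideal.span {x}, ⟨?_, fun B hB => ?_⟩, ?_⟩
  · simpa using hx
  · by_contra hne
    obtain ⟨y, hyB, hy⟩ := Submodule.exists_mem_ne_zero_of_ne_bot hne
    have hyx := hB.le hyB
    have hle : Ideal.span {x} ≤ A := by simpa [Ideal.span_le] using hxA
    refine hmin y ⟨hle hyx, hy⟩ ⟨hyx, fun hxy => hB.not_ge ?_⟩
    rw [Ideal.span_le, Set.singleton_subset_iff]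
    have : Ideal.span {y} ≤ B := by simpa [Ideal.span_le] using hyB
    exact this hxy
  · simpa [Ideal.span_le] using hxA

/-- Take `Rf` minimal such that it complements some semisimple `A` to `R` (the sum need not be
direct). If `f ≠ 0`, then `Rf` contains a simple `T`, and some maximal `C` misses `T` because the
radical vanishes. The `C`-component of `f` generates a smaller ideal that works with `A ⊔ T`. -/
theorem IsSemisimpleRing.of_hasPrincipalLeftDCC (h : HasPrincipalLeftDCC R)
    (hJ : Ring.jacobson R = ⊥) : IsSemisimpleRing R := by
  have hbot : IsSemisimpleModule R (⊥ : Ideal R) := by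
    have : Subsingleton (Submodule R (⊥ : Ideal R)) :=
      (Submodule.subsingleton_iff R).2 inferInstance
    exact (isSemisimpleModule_iff ..).mpr Subsingleton.instComplementedLattice
  obtain ⟨f, ⟨A, hA, hAf⟩, hmin⟩ := h.wellFounded.has_min
    {f | ∃ A : Ideal R, IsSemisimpleModule R A ∧ A ⊔ Ideal.span {f} = ⊤}
    ⟨1, ⊥, hbot, by simp⟩
  have hf : f = 0 := by
    by_contra hf
    obtain ⟨T, hT, hTf⟩ := h.exists_isAtom_le (A := Ideal.span {f}) (by simpa using hf)
    obtain ⟨C, hC, hTC⟩ : ∃ C : Ideal R, C.IsMaximal ∧ ¬ T ≤ C := by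
      by_contra! hcon
      refine hT.1 (le_bot_iff.1 ?_)
      rw [← hJ, Ring.jacobson_eq_sInf_isMaximal]
      exact le_sInf hcon
    have htop : C ⊔ T = ⊤ := hC.out.2 _ (lt_of_le_of_ne le_sup_left fun hCT =>
      hTC (hCT ▸ le_sup_right))
    obtain ⟨c, hc, t, ht, hct⟩ := Submodule.mem_sup.1 (htop ▸ Submodule.mem_top : f ∈ C ⊔ T)
    have hTs : IsSemisimpleModule R T := by
      have := isSimpleModule_iff_isAtom.2 hT
      infer_instance
    refine hmin c ⟨A ⊔ T, IsSemisimpleModule.sup hA hTs, ?_⟩ ⟨?_, fun hfc => hTC ?_⟩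
    · rw [eq_top_iff, ← hAf, sup_le_iff, Ideal.span_le, Set.singleton_subset_iff]
      refine ⟨le_sup_left.trans le_sup_left, ?_⟩
      rw [← hct]
      refine add_mem (Submodule.mem_sup_right (Ideal.mem_span_singleton_self c)) ?_
      exact Submodule.mem_sup_left (Submodule.mem_sup_right ht)
    · rw [eq_sub_of_add_eq hct]
      exact sub_mem (Ideal.mem_span_singleton_self f) (hTf ht)
    · have h1 : Ideal.span {f} ≤ Ideal.span {c} := by simpa [Ideal.span_le] using hfc
      have h2 : Ideal.span {c} ≤ C := by simpa [Ideal.span_le] using hc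
      exact hTf.trans (h1.trans h2)
  subst hf
  have hAtop : A = ⊤ := by simpa using hAf
  subst hAtop
  exact IsSemisimpleModule.congr Submodule.topEquiv.symm

end Chain

/-! ### T-nilpotent ideals, Nakayama's lemma and projective covers -/

section TNilpotent

variable {S : Type*} [Ring S] {I : Ideal S} {M : Type*} [AddCommGroup M] [Module S M]

theorem Ideal.IsTNilpotent.isNilpotent (hI : I.IsTNilpotent) {a : S} (ha : a ∈ I) :
    IsNilpotent a :=
  hI (fun n => a ^ n) (fun _ => a) (fun _ => ha) fun n => pow_succ a n

/-- If `p` does not kill `M = IM`, then neither does `p * a` for some `a ∈ I`. Iterating from `p =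
1` gives products that never vanish. -/
theorem Ideal.IsTNilpotent.subsingleton (hI : I.IsTNilpotent)
    (hM : I • (⊤ : Submodule S M) = ⊤) : Subsingleton M := by
  by_contra hcon
  rw [not_subsingleton_iff_nontrivial] at hcon
  have step : ∀ p : {p : S // ∃ m : M, p • m ≠ 0}, ∃ a ∈ I, ∃ m : M, (p.1 * a) • m ≠ 0 := by
    rintro ⟨p, m, hm⟩
    by_contra! h
    have key : ∀ y ∈ I • (⊤ : Submodule S M), p • y = 0 := fun y hy =>
      Submodule.smul_induction_on hy (fun a ha z _ => by rw [← mul_smul]; exact h a ha z)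
        fun y z hy hz => by rw [smul_add, hy, hz, add_zero]
    exact hm (key m (by rw [hM]; exact Submodule.mem_top))
  choose a haI ha using step
  obtain ⟨m, hm⟩ := exists_ne (0 : M)
  let p : ℕ → {p : S // ∃ m : M, p • m ≠ 0} := fun n =>
    Nat.rec ⟨1, m, by simpa using hm⟩ (fun _ p => ⟨p.1 * a p, ha p⟩) n
  obtain ⟨n, hn⟩ := hI (fun n => (p n).1) (fun n => a (p n)) (fun n => haI _) fun n => rfl
  obtain ⟨m, hm⟩ := (p n).2
  exact hm (by rw [show (p n).1 = 0 from hn, zero_smul])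

theorem Ideal.IsTNilpotent.eq_top_of_sup_eq_top (hI : I.IsTNilpotent) {U : Submodule S M}
    (hU : U ⊔ I • ⊤ = ⊤) : U = ⊤ := by
  rw [← Submodule.Quotient.subsingleton_iff]
  refine hI.subsingleton ?_
  have h := congrArg (Submodule.map U.mkQ) hU
  rwa [Submodule.map_sup, Submodule.mkQ_map_self, bot_sup_eq, Submodule.map_smul'',
    Submodule.map_top, Submodule.range_mkQ] at h

/-- The annihilator of a generator contains `I` and is generated modulo `I` by an idempotent `e'`.
Idempotents lift modulo the nil ideal `I`; a lift `e` of `1 - e'` gives the cover `Se`. -/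
theorem Ideal.IsTNilpotent.exists_projective_surjective_of_isSimpleModule [I.IsTwoSided]
    [IsSemisimpleRing (S ⧸ I)] (hI : I.IsTNilpotent) [IsSimpleModule S M] :
    ∃ (P : Submodule S S) (φ : P →ₗ[S] M), Module.Projective S P ∧ Function.Surjective φ ∧
      LinearMap.ker φ ≤ I • ⊤ := by
  have := IsSimpleModule.nontrivial S M
  obtain ⟨t, ht⟩ := exists_ne (0 : M)
  have hbot : I • (⊤ : Submodule S M) = ⊥ :=
    (eq_bot_or_eq_top _).resolve_right fun h => not_subsingleton M (hI.subsingleton h)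
  set m : Ideal S := LinearMap.ker (LinearMap.toSpanSingleton S M t) with hm
  have mem_m : ∀ s, s ∈ m ↔ s • t = 0 := fun s => by simp [hm]
  have hIm : I ≤ m := fun s hs => (mem_m s).2 <| by
    rw [← Submodule.mem_bot S, ← hbot]
    exact Submodule.smul_mem_smul hs Submodule.mem_top
  obtain ⟨e', he', hspan⟩ :=
    IsSemisimpleRing.ideal_eq_span_idempotent (m.map (Ideal.Quotient.mk I))
  obtain ⟨e, he, hee'⟩ := exists_isIdempotentElem_eq_of_ker_isNilpotent (Ideal.Quotient.mk I)
    (fun x hx => hI.isNilpotent (by simpa using hx)) (1 - e')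
    (Ideal.Quotient.mk_surjective _) he'.one_sub
  have hem : 1 - e ∈ m := by
    have h1 : Ideal.Quotient.mk I (1 - e) ∈ m.map (Ideal.Quotient.mk I) := by
      rw [hspan, map_sub, map_one, hee', sub_sub_cancel]
      exact Ideal.mem_span_singleton_self e'
    obtain ⟨y, hy, hye⟩ := (Ideal.mem_map_iff_of_surjective _ Ideal.Quotient.mk_surjective).1 h1
    rw [Ideal.Quotient.eq] at hye
    rw [← sub_sub_cancel y (1 - e)]
    exact sub_mem hy (hIm hye)
  have het : e • t = t := by
    have := (mem_m _).1 hem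
    rw [sub_smul, one_smul, sub_eq_zero] at this
    exact this.symm
  have mul_e : ∀ x ∈ Ideal.span {e}, x * e = x := by
    intro x hx
    obtain ⟨y, rfl⟩ := Ideal.mem_span_singleton'.1 hx
    rw [mul_assoc, he.eq]
  refine ⟨Ideal.span {e}, LinearMap.toSpanSingleton S M t ∘ₗ Submodule.subtype _, ?_, ?_, ?_⟩
  · refine Module.Projective.of_split (M := S) (Submodule.subtype _)
      ((LinearMap.toSpanSingleton S S e).codRestrict _ fun s => ?_) ?_
    · exact Ideal.mem_span_singleton'.2 ⟨s, rfl⟩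
    · ext x
      exact mul_e x x.2
  · intro y
    obtain ⟨s, rfl⟩ := IsSimpleModule.toSpanSingleton_surjective S ht y
    refine ⟨⟨s * e, Ideal.mem_span_singleton'.2 ⟨s, rfl⟩⟩, ?_⟩
    simp [mul_smul, het]
  · rintro ⟨x, hx⟩ hxt
    have hxm : x ∈ m := (mem_m x).2 (by simpa using hxt)
    have hxI : x ∈ I := by
      have h1 := Ideal.mem_map_of_mem (Ideal.Quotient.mk I) hxm
      rw [hspan] at h1
      obtain ⟨r, hr⟩ := Ideal.mem_span_singleton'.1 h1
      rw [← Ideal.Quotient.eq_zero_iff_mem, ← mul_e x hx, map_mul, ← hr, hee', mul_assoc,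
        mul_sub, mul_one, he'.eq, sub_self, mul_zero]
    have : (⟨x, hx⟩ : Ideal.span {e}) = x • ⟨e, Ideal.mem_span_singleton_self e⟩ :=
      Subtype.ext (mul_e x hx).symm
    rw [this]
    exact Submodule.smul_mem_smul hxI Submodule.mem_top

end TNilpotent

/-- `M / IM` is a direct sum of simple modules. The sum of their covers lifts to `ψ` into `M`;
Nakayama makes `ψ` surjective and its kernel, contained in `IP`, superfluous. -/
theorem Ideal.IsTNilpotent.hasProjectiveCover {S : Type u} [Ring S] {I : Ideal S} [I.IsTwoSided]
    [IsSemisimpleRing (S ⧸ I)] (hI : I.IsTNilpotent) (M : Type u) [AddCommGroup M] [Module S M] :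
    HasProjectiveCover S M := by
  classical
  have htor := Module.isTorsionBySet_quotient_ideal_smul M I
  have hss : IsSemisimpleModule S (M ⧸ I • (⊤ : Submodule S M)) := by
    let := htor.module
    exact htor.isSemisimpleModule_iff.1 inferInstance
  obtain ⟨s, E, hs⟩ := isSemisimpleModule_iff_exists_linearEquiv_dfinsupp.1 hss
  have hcov := fun m : s =>
    haveI := hs m
    hI.exists_projective_surjective_of_isSimpleModule (M := m.1)
  choose P φ hP hφ hker using hcov
  choose g hg using fun m : s => Module.projective_lifting_property (I • (⊤ : Submodule S M)).mkQ
    (E.symm.toLinearMap ∘ₗ DFinsupp.lsingle m ∘ₗ φ m) (Submodule.mkQ_surjective _)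
  let ψ : (Π₀ m : s, P m) →ₗ[S] M := DFinsupp.coprodMap g
  have hψ : ∀ p, (I • (⊤ : Submodule S M)).mkQ (ψ p) =
      E.symm (DFinsupp.mapRange.linearMap φ p) := by
    intro p
    have : (I • (⊤ : Submodule S M)).mkQ ∘ₗ ψ =
        E.symm.toLinearMap ∘ₗ DFinsupp.mapRange.linearMap φ := by
      ext m x : 2
      have := LinearMap.congr_fun (hg m) x
      simpa [ψ, DFinsupp.coprodMap_apply_single] using this
    exact LinearMap.congr_fun this p
  refine ⟨Π₀ m : s, P m, inferInstance, inferInstance, ψ, inferInstance, ?_, ?_⟩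
  · rw [← LinearMap.range_eq_top]
    refine hI.eq_top_of_sup_eq_top (eq_top_iff.2 fun x _ => ?_)
    obtain ⟨p, hp⟩ := (DFinsupp.mapRange_surjective (fun m => φ m) fun m => map_zero _).2 hφ
      (E ((I • (⊤ : Submodule S M)).mkQ x))
    refine Submodule.mem_sup.2 ⟨ψ p, ⟨p, rfl⟩, x - ψ p, ?_, add_sub_cancel _ _⟩
    rw [← Submodule.Quotient.mk_eq_zero, ← Submodule.mkQ_apply, map_sub, hψ,
      sub_eq_zero, LinearEquiv.eq_symm_apply]
    exact hp.symm
  · intro U hU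
    refine hI.eq_top_of_sup_eq_top (eq_top_iff.2 (hU.ge.trans (sup_le_sup_left (fun p hp => ?_) U)))
    have h0 := hψ p
    rw [LinearMap.mem_ker.1 hp, map_zero, eq_comm, LinearEquiv.map_eq_zero_iff] at h0
    rw [← DFinsupp.sum_single (f := p)]
    refine Submodule.sum_mem _ fun m _ => ?_
    have hpm : p m ∈ LinearMap.ker (φ m) := by
      have := DFunLike.congr_fun h0 m
      simpa using this
    have := Submodule.smul_top_le_comap_smul_top I
      (DFinsupp.lsingle (M := fun m : s => P m) m) (hker m hpm)
    exact this

theorem HasPrincipalLeftDCC.isRightPerfect {R : Type u} [Ring R] (h : HasPrincipalLeftDCC R) :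
    IsRightPerfect R := by
  intro M _ _
  let J := Ring.jacobson R
  have hss : IsSemisimpleRing (R ⧸ J) := .of_hasPrincipalLeftDCC
    (h.of_surjective (Ideal.Quotient.mk J) Ideal.Quotient.mk_surjective)
    (Ring.jacobson_quotient_jacobson R)
  let f : Rᵐᵒᵖ →+* (R ⧸ J)ᵐᵒᵖ := (Ideal.Quotient.mk J).op
  have hf : Function.Surjective f := fun x => by
    obtain ⟨r, hr⟩ := Ideal.Quotient.mk_surjective x.unop
    exact ⟨.op r, MulOpposite.unop_injective hr⟩
  have : IsSemisimpleRing (Rᵐᵒᵖ ⧸ RingHom.ker f) :=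
    (RingHom.quotientKerEquivOfSurjective hf).symm.isSemisimpleRing
  refine Ideal.IsTNilpotent.hasProjectiveCover (I := RingHom.ker f) (fun x a ha hx => ?_) M
  obtain ⟨n, s, hs⟩ := h (fun n => (x n).unop) (fun n => (a n).unop) fun n => by
    rw [hx, MulOpposite.unop_mul]
  refine ⟨n, MulOpposite.unop_injective ?_⟩
  have haJ : (a n).unop ∈ J := by
    rw [← Ideal.Quotient.eq_zero_iff_mem]
    exact congrArg MulOpposite.unop (RingHom.mem_ker.1 (ha n))
  rw [show J = (⊥ : Ideal R).jacobson from Ideal.jacobson_bot.symm] at haJ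
  -- `z` is a left inverse of `1 - s * a n`, an element that kills `x n`.
  obtain ⟨z, hz⟩ := Ideal.mem_jacobson_iff.1 haJ (-s)
  rw [Submodule.mem_bot] at hz
  have hs' : (x n).unop = s * ((a n).unop * (x n).unop) := by
    rw [← MulOpposite.unop_mul, ← hx]; exact hs
  have key : (z * -s * (a n).unop + z - 1) * (x n).unop
      = z * ((x n).unop - s * ((a n).unop * (x n).unop)) - (x n).unop := by noncomm_ring
  rw [hz, zero_mul, ← hs', sub_self, mul_zero, zero_sub, eq_comm, neg_eq_zero] at key
  exact key

/-! ### Pure monomorphisms -/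

section Purity

variable {S : Type u} [Ring S]

theorem LinearMap.exists_comp_eq_of_ker_le {F C A : Type*} [AddCommGroup F] [Module S F]
    [AddCommGroup C] [Module S C] [AddCommGroup A] [Module S A] {p : F →ₗ[S] C}
    (hp : Function.Surjective p) (q : F →ₗ[S] A) (h : ∀ x, p x = 0 → q x = 0) :
    ∃ g : C →ₗ[S] A, g ∘ₗ p = q := by
  refine ⟨(LinearMap.ker p).liftQ q h ∘ₗ (p.quotKerEquivOfSurjective hp).symm, ?_⟩
  ext x
  have : (p.quotKerEquivOfSurjective hp).symm (p x) = (LinearMap.ker p).mkQ x := by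
    rw [LinearEquiv.symm_apply_eq]
    rfl
  rw [LinearMap.comp_apply, LinearMap.comp_apply, LinearEquiv.coe_coe, this]
  rfl

variable {κ : Cardinal.{u}} {B A N : Type u} [AddCommGroup B] [Module S B]
  [AddCommGroup A] [Module S A] [AddCommGroup N] [Module S N]

/-- A monomorphism is `κ`-pure if each set of fewer than `κ` elements of its range is killed by an
endomorphism which is the identity modulo the range. -/
theorem IsPureMono.of_exists_endomorphism {f : B →ₗ[S] A} (hf : Function.Injective f)
    (h : ∀ s : Set A, s ⊆ LinearMap.range f → Cardinal.mk s < κ → ∃ π : A →ₗ[S] A,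
      (∀ x, π x - x ∈ LinearMap.range f) ∧ ∀ x ∈ s, π x = 0) :
    IsPureMono κ f := by
  refine ⟨hf, fun C _ _ ⟨ι, p, rels, hι, hp, hrels, hspan⟩ t => ?_⟩
  obtain ⟨q, hq⟩ := Module.projective_lifting_property (LinearMap.range f).mkQ (t ∘ₗ p)
    (Submodule.mkQ_surjective _)
  have hq' : ∀ x, (LinearMap.range f).mkQ (q x) = t (p x) := LinearMap.congr_fun hq
  obtain ⟨π, hπ, hπs⟩ := h (q '' rels)
    (by
      rintro _ ⟨r, hr, rfl⟩
      have : p r = 0 := by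
        rw [← LinearMap.mem_ker, ← hspan]
        exact Submodule.subset_span hr
      rw [SetLike.mem_coe, ← Submodule.Quotient.mk_eq_zero, ← Submodule.mkQ_apply, hq', this,
        map_zero])
    (Cardinal.mk_image_le.trans_lt hrels)
  have hker : Submodule.span S rels ≤ LinearMap.ker (π ∘ₗ q) :=
    Submodule.span_le.2 fun r hr => hπs _ ⟨r, hr, rfl⟩
  obtain ⟨g, hg⟩ := LinearMap.exists_comp_eq_of_ker_le hp (π ∘ₗ q) fun x hx =>
    hker (hspan ▸ LinearMap.mem_ker.2 hx)
  have hπ' : (LinearMap.range f).mkQ ∘ₗ π = (LinearMap.range f).mkQ :=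
    LinearMap.ext fun x => (Submodule.Quotient.eq _).2 (hπ x)
  refine ⟨g, ?_⟩
  rw [← LinearMap.cancel_right hp, LinearMap.comp_assoc, hg, ← LinearMap.comp_assoc, hπ', hq]

/-- With `q` lifting `t ∘ p` to `A` and `k` lifting the image of `t` to `N`, the map `g ∘ q - k ∘ p`
lands in a copy of `B`. Subtracting it from `q` there makes `q` vanish on the relations. -/
theorem IsPureMono.of_comp {f : B →ₗ[S] A} {g : A →ₗ[S] N} (h : IsPureMono κ (g ∘ₗ f)) :
    IsPureMono κ f := by
  refine ⟨fun x y hxy => h.1 (congrArg g hxy), fun C _ _ hC t => ?_⟩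
  obtain ⟨ι, p, rels, -, hp, -, -⟩ := id hC
  obtain ⟨q, hq⟩ := Module.projective_lifting_property (LinearMap.range f).mkQ (t ∘ₗ p)
    (Submodule.mkQ_surjective _)
  have hle : LinearMap.range f ≤ (LinearMap.range (g ∘ₗ f)).comap g := by
    rintro _ ⟨x, rfl⟩
    exact ⟨x, rfl⟩
  let g' : (A ⧸ LinearMap.range f) →ₗ[S] N ⧸ LinearMap.range (g ∘ₗ f) :=
    Submodule.mapQ _ _ g hle
  have hg' : ∀ x, g' ((LinearMap.range f).mkQ x) = (LinearMap.range (g ∘ₗ f)).mkQ (g x) :=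
    fun x => rfl
  obtain ⟨k, hk⟩ := h.2 C hC (g' ∘ₗ t)
  have hmem : ∀ x, g (q x) - k (p x) ∈ LinearMap.range (g ∘ₗ f) := by
    intro x
    have h1 : (LinearMap.range (g ∘ₗ f)).mkQ (k (p x)) = g' (t (p x)) := LinearMap.congr_fun hk _
    have h2 : (LinearMap.range f).mkQ (q x) = t (p x) := LinearMap.congr_fun hq x
    rw [← Submodule.Quotient.mk_eq_zero, ← Submodule.mkQ_apply, map_sub, h1, ← h2, hg', sub_self]
  let e := LinearEquiv.ofInjective (g ∘ₗ f) h.1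
  let l : (ι →₀ S) →ₗ[S] B :=
    e.symm ∘ₗ (g ∘ₗ q - k ∘ₗ p).codRestrict (LinearMap.range (g ∘ₗ f)) hmem
  have hl : ∀ x, g (f (l x)) = g (q x) - k (p x) := fun x =>
    congrArg Subtype.val (e.apply_symm_apply ⟨_, hmem x⟩)
  obtain ⟨j, hj⟩ := LinearMap.exists_comp_eq_of_ker_le hp (q - f ∘ₗ l) fun x hx => by
    have hqx : q x ∈ LinearMap.range f := by
      rw [← Submodule.Quotient.mk_eq_zero, ← Submodule.mkQ_apply]
      have : (LinearMap.range f).mkQ (q x) = t (p x) := LinearMap.congr_fun hq x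
      rw [this, hx, map_zero]
    obtain ⟨y, hy⟩ := hqx
    have h1 := hl x
    rw [hx, map_zero, sub_zero, ← hy] at h1
    have h2 : l x = y := h.1 h1
    simp [h2, hy]
  refine ⟨j, ?_⟩
  rw [← LinearMap.cancel_right hp, LinearMap.comp_assoc, hj, LinearMap.comp_sub, hq,
    ← LinearMap.comp_assoc, LinearMap.range_mkQ_comp, LinearMap.zero_comp, sub_zero]

theorem IsPureMono.exists_retraction {f : B →ₗ[S] A} (h : IsPureMono κ f)
    (hC : IsLTPresented κ S (A ⧸ LinearMap.range f)) : ∃ ρ : A →ₗ[S] B, ρ ∘ₗ f = LinearMap.id := by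
  obtain ⟨g, hg⟩ := h.2 _ hC LinearMap.id
  have hmem : ∀ x, x - g ((LinearMap.range f).mkQ x) ∈ LinearMap.range f := by
    intro x
    have h1 : (LinearMap.range f).mkQ (g ((LinearMap.range f).mkQ x)) = (LinearMap.range f).mkQ x :=
      LinearMap.congr_fun hg _
    rw [← Submodule.Quotient.mk_eq_zero, ← Submodule.mkQ_apply, map_sub, h1, sub_self]
  let e := LinearEquiv.ofInjective f h.1
  refine ⟨e.symm ∘ₗ (LinearMap.id - g ∘ₗ (LinearMap.range f).mkQ).codRestrict _ hmem, ?_⟩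
  ext x
  have h0 : (LinearMap.range f).mkQ (f x) = 0 := by simp
  change e.symm ⟨f x - g ((LinearMap.range f).mkQ (f x)), _⟩ = x
  rw [LinearEquiv.symm_apply_eq]
  apply Subtype.ext
  change f x - g ((LinearMap.range f).mkQ (f x)) = f x
  rw [h0, map_zero, sub_zero]

end Purity

/-! ### Bass modules -/

section Bass

variable {S : Type*} [Ring S]

/-- The endomorphism of the free module `S^(ℕ)` with `e n ↦ e n - a n • e (n + 1)`. Its cokernel is
the Bass module of the sequence `a`. -/
noncomputable def bassMap (a : ℕ → S) : (ℕ →₀ S) →ₗ[S] (ℕ →₀ S) :=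
  Finsupp.linearCombination S fun n => Finsupp.single n 1 - a n • Finsupp.single (n + 1) 1

theorem bassMap_single (a : ℕ → S) (n : ℕ) :
    bassMap a (Finsupp.single n 1) = Finsupp.single n 1 - a n • Finsupp.single (n + 1) 1 := by
  simp [bassMap]

theorem bassMap_apply_zero (a : ℕ → S) (c : ℕ →₀ S) : bassMap a c 0 = c 0 := by
  induction c using Finsupp.induction_linear with
  | zero => simp
  | add f g hf hg => simp [hf, hg]
  | single n r => simp [bassMap, Finsupp.single_apply]

theorem bassMap_apply_succ (a : ℕ → S) (c : ℕ →₀ S) (n : ℕ) :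
    bassMap a c (n + 1) = c (n + 1) - c n * a n := by
  induction c using Finsupp.induction_linear with
  | zero => simp
  | add f g hf hg =>
    rw [(bassMap a).map_add, Finsupp.add_apply, hf, hg, Finsupp.add_apply, Finsupp.add_apply]
    noncomm_ring
  | single m r =>
    by_cases h : m = n
    · subst h
      simp [bassMap]
    · simp [bassMap, Finsupp.single_apply, h]

theorem bassMap_injective (a : ℕ → S) : Function.Injective (bassMap a) := by
  rw [injective_iff_map_eq_zero]
  intro c hc
  ext n
  induction n with
  | zero => rw [← bassMap_apply_zero a, hc]
  | succ n ih =>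
    have := bassMap_apply_succ a c n
    rw [hc, ih] at this
    simpa using this.symm

/-- The vectors `v n = ρ (e n)` satisfy `v n = e n + a n • v (n + 1)`, so `y 0 • v 0` has `k`-th
coordinate `y k + y (k + 1) * v (k + 1) k`. This vanishes for `k` outside the finite support of `v
0`. -/
theorem exists_eq_mul_of_bassMap_retraction {a : ℕ → S} {ρ : (ℕ →₀ S) →ₗ[S] (ℕ →₀ S)}
    (hρ : ρ ∘ₗ bassMap a = LinearMap.id) {y : ℕ → S} (hy : ∀ n, y (n + 1) = y n * a n) :
    ∃ n s, y n = y (n + 1) * s := by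
  let v : ℕ → ℕ →₀ S := fun n => ρ (Finsupp.single n 1)
  have hv : ∀ n, v n = Finsupp.single n 1 + a n • v (n + 1) := fun n => by
    have := LinearMap.congr_fun hρ (Finsupp.single n 1)
    rw [LinearMap.comp_apply, bassMap_single, map_sub, map_smul, LinearMap.id_apply,
      sub_eq_iff_eq_add] at this
    exact this
  have key : ∀ m k, m ≤ k → y 0 * v 0 k = y m * v m k := by
    intro m
    induction m with
    | zero => exact fun _ _ => rfl
    | succ m ih =>
      intro k hk
      rw [ih k (by omega), hv m, hy, Finsupp.add_apply, Finsupp.single_eq_of_ne (by omega),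
        zero_add, Finsupp.smul_apply, smul_eq_mul, mul_assoc]
  obtain ⟨k, hk⟩ := Infinite.exists_notMem_finset (v 0).support
  refine ⟨k, -v (k + 1) k, ?_⟩
  have h := key k k le_rfl
  rw [Finsupp.notMem_support_iff.1 hk, mul_zero, hv k, Finsupp.add_apply,
    Finsupp.single_eq_same, Finsupp.smul_apply, smul_eq_mul, mul_add, mul_one, ← mul_assoc,
    ← hy] at h
  rw [mul_neg, eq_neg_iff_add_eq_zero, ← h]

/-- A solution `x` modulo `K` of the recursion `x n = a n • x (n + 1) + w n` which is exact from `m`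
on can be changed modulo `K` to an exact solution. -/
theorem exists_exact_solution {A : Type*} [AddCommGroup A] [Module S A] (K : Submodule S A)
    (a : ℕ → S) (w : ℕ → A) (m : ℕ) (x : ℕ → A) (hK : ∀ n, w n - (x n - a n • x (n + 1)) ∈ K)
    (hm : ∀ n, m ≤ n → w n = x n - a n • x (n + 1)) :
    ∃ v : ℕ → A, (∀ n, v n - a n • v (n + 1) = w n) ∧ ∀ n, v n - x n ∈ K := by
  induction m generalizing x with
  | zero => exact ⟨x, fun n => (hm n n.zero_le).symm, fun n => by simp⟩
  | succ m ih =>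
    -- This makes relation `m` exact; later relations do not involve `x m`, and earlier ones change
    -- only modulo `K`.
    let x' := Function.update x m (a m • x (m + 1) + w m)
    have hx' : ∀ n, x' n - x n ∈ K := by
      intro n
      by_cases h : n = m
      · subst h
        have := hK n
        rw [show x' n = a n • x (n + 1) + w n from Function.update_self ..]
        convert this using 1
        abel
      · rw [show x' n = x n from Function.update_of_ne h ..]
        simp
    obtain ⟨v, hv, hvK⟩ := ih x'
      (fun n => by
        have h1 := sub_mem (hK n) (sub_mem (hx' n) (K.smul_mem (a n) (hx' (n + 1))))
        convert h1 using 1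
        rw [smul_sub]
        abel)
      (fun n hn => by
        have h1 : x' (n + 1) = x (n + 1) := Function.update_of_ne (by omega) ..
        rcases hn.eq_or_lt with rfl | hn
        · rw [h1, show x' m = a m • x (m + 1) + w m from Function.update_self ..]
          abel
        · rw [h1, show x' n = x n from Function.update_of_ne (by omega) .., hm n hn])
    refine ⟨v, hv, fun n => ?_⟩
    rw [← sub_add_sub_cancel (v n) (x' n) (x n)]
    exact add_mem (hvK n) (hx' n)

end Bass

theorem isPureMono_bassMap {S : Type u} [Ring S] (a : ℕ → S) :
    IsPureMono Cardinal.aleph0 (bassMap a) := by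
  refine .of_exists_endomorphism (bassMap_injective a) fun s hs hcard => ?_
  have hfin : s.Finite := Cardinal.lt_aleph0_iff_set_finite.1 hcard
  have hs' : ∀ y ∈ s, ∃ c, bassMap a c = y := fun y hy => hs hy
  choose! c hc using hs'
  obtain ⟨m, hm⟩ : ∃ m, ∀ y ∈ s, (c y).support ⊆ Finset.range m := by
    obtain ⟨m, hm⟩ := (hfin.toFinset.biUnion fun y => (c y).support).exists_nat_subset_range
    exact ⟨m, fun y hy => (Finset.subset_biUnion_of_mem (fun y => (c y).support)
      (hfin.mem_toFinset.2 hy)).trans hm⟩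
  set K := LinearMap.range (bassMap a) with hKdef
  let x : ℕ → ℕ →₀ S := fun n => Finsupp.single n 1
  have hx : ∀ n, x n - a n • x (n + 1) ∈ K := fun n => ⟨Finsupp.single n 1, bassMap_single a n⟩
  -- The new generators satisfy the first `m` Bass relations exactly, and `s` involves no others.
  obtain ⟨v, hv, hvx⟩ := exists_exact_solution K a
    (fun n => if n < m then 0 else x n - a n • x (n + 1)) m x
    (fun n => by
      split_ifs
      · rw [zero_sub]
        exact K.neg_mem (hx n)
      · simp)
    (fun n hn => if_neg hn.not_gt)
  refine ⟨Finsupp.linearCombination S v, fun z => ?_, fun y hy => ?_⟩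
  · have : K.mkQ ∘ₗ Finsupp.linearCombination S v = K.mkQ := by
      ext n : 2
      have : K.mkQ (v n) = K.mkQ (x n) := (Submodule.Quotient.eq K).2 (hvx n)
      simpa using this
    exact (Submodule.Quotient.eq K).1 (LinearMap.congr_fun this z)
  · rw [← hc y hy, ← LinearMap.comp_apply]
    have : Finsupp.linearCombination S v ∘ₗ bassMap a =
        Finsupp.linearCombination S fun n => if n < m then 0 else x n - a n • x (n + 1) := by
      ext n : 2
      have := hv n
      simpa [bassMap] using this
    rw [this, Finsupp.linearCombination_apply, Finsupp.sum]
    refine Finset.sum_eq_zero fun n hn => ?_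
    rw [if_pos (Finset.mem_range.1 (hm y hy hn)), smul_zero]

theorem isLTPresented_bassMap {S : Type u} [Ring S] (a : ℕ → S) :
    IsLTPresented (Cardinal.aleph 1) S ((ℕ →₀ S) ⧸ LinearMap.range (bassMap a)) := by
  let e : (ULift.{u} ℕ →₀ S) ≃ₗ[S] (ℕ →₀ S) := Finsupp.domLCongr Equiv.ulift
  refine ⟨ULift.{u} ℕ, (LinearMap.range (bassMap a)).mkQ ∘ₗ e.toLinearMap,
    Set.range fun n => e.symm (bassMap a (Finsupp.single n 1)), ?_,
    (Submodule.mkQ_surjective _).comp e.surjective, ?_, ?_⟩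
  · exact (Cardinal.mk_le_aleph0).trans_lt Cardinal.aleph0_lt_aleph_one
  · have : (Set.range fun n => e.symm (bassMap a (Finsupp.single n 1))).Countable :=
      Set.countable_range _
    exact (Cardinal.le_aleph0_iff_set_countable.2 this).trans_lt Cardinal.aleph0_lt_aleph_one
  · rw [LinearMap.ker_comp, Submodule.ker_mkQ]
    have h1 : LinearMap.range (bassMap a) =
        Submodule.span S (Set.range fun n => bassMap a (Finsupp.single n 1)) := by
      simp only [bassMap_single]
      exact Finsupp.range_linearCombination _
    have h2 : (LinearMap.range (bassMap a)).comap e.toLinearMap =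
        (LinearMap.range (bassMap a)).map e.symm.toLinearMap :=
      (Submodule.map_equiv_eq_comap_symm e.symm _).symm
    rw [h2, h1, Submodule.map_span, ← Set.range_comp]
    rfl

/-! ### Tree modules -/

section Tree

variable {S : Type*} [Ring S] {X T : Type*}

/-- The generator of the free module `S^(T) ⊕ (S^(ℕ))^(X)` given by a branch `b` and `n : ℕ`. -/
noncomputable def branchVec (S : Type*) [Ring S] (T : Type*) {X : Type*} (b : X) (n : ℕ) :
    (T →₀ S) × (X →₀ ℕ →₀ S) :=
  (0, Finsupp.single b (Finsupp.single n 1))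

/-- The generator of the free module `S^(T) ⊕ (S^(ℕ))^(X)` given by a node of the tree. -/
noncomputable def nodeVec (S : Type*) [Ring S] (X : Type*) {T : Type*} (t : T) :
    (T →₀ S) × (X →₀ ℕ →₀ S) :=
  (Finsupp.single t 1, 0)

/-- The relations of the tree module of a sequence `a`: it is generated by the nodes `t` of the tree
and, for each branch `b`, elements `e b n` with
`e b n - a n • e b (n + 1) = node b n`. -/
noncomputable def treeMap (a : ℕ → S) (node : X → ℕ → T) :
    (X →₀ ℕ →₀ S) →ₗ[S] (T →₀ S) × (X →₀ ℕ →₀ S) :=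
  Finsupp.lsum ℕ fun b => Finsupp.linearCombination S fun n =>
    branchVec S T b n - a n • branchVec S T b (n + 1) - nodeVec S X (node b n)

theorem treeMap_single (a : ℕ → S) (node : X → ℕ → T) (b : X) (n : ℕ) :
    treeMap a node (Finsupp.single b (Finsupp.single n 1)) =
      branchVec S T b n - a n • branchVec S T b (n + 1) - nodeVec S X (node b n) := by
  simp [treeMap]

theorem snd_comp_treeMap (a : ℕ → S) (node : X → ℕ → T) :
    LinearMap.snd S _ _ ∘ₗ treeMap a node = Finsupp.mapRange.linearMap (bassMap a) := by
  ext b n : 4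
  simp [treeMap, branchVec, nodeVec, bassMap]

theorem treeMap_injective (a : ℕ → S) (node : X → ℕ → T) : Function.Injective (treeMap a node) := by
  have h : Function.Injective (Finsupp.mapRange.linearMap (α := X) (bassMap a)) :=
    Finsupp.mapRange_injective _ (map_zero _) (bassMap_injective a)
  rw [← snd_comp_treeMap a node] at h
  exact Function.Injective.of_comp (f := LinearMap.snd S _ _) h

theorem eq_top_of_nodeVec_mem_of_branchVec_mem {L : Submodule S ((T →₀ S) × (X →₀ ℕ →₀ S))}
    (hd : ∀ t, nodeVec S X t ∈ L) (he : ∀ b n, branchVec S T b n ∈ L) : L = ⊤ := by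
  have h1 : ∀ p : T →₀ S, LinearMap.inl S (T →₀ S) (X →₀ ℕ →₀ S) p ∈ L := by
    intro p
    induction p using Finsupp.induction_linear with
    | zero => rw [map_zero]; exact L.zero_mem
    | add f g hf hg => rw [map_add]; exact L.add_mem hf hg
    | single t r =>
      have := L.smul_mem r (hd t)
      simpa [nodeVec] using this
  have h2 : ∀ q : X →₀ ℕ →₀ S, LinearMap.inr S (T →₀ S) (X →₀ ℕ →₀ S) q ∈ L := by
    intro q
    induction q using Finsupp.induction_linear with
    | zero => rw [map_zero]; exact L.zero_mem
    | add f g hf hg => rw [map_add]; exact L.add_mem hf hg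
    | single b c =>
      induction c using Finsupp.induction_linear with
      | zero => rw [Finsupp.single_zero, map_zero]; exact L.zero_mem
      | add f g hf hg => rw [Finsupp.single_add, map_add]; exact L.add_mem hf hg
      | single n r =>
        have := L.smul_mem r (he b n)
        simpa [branchVec] using this
  refine eq_top_iff.2 fun x _ => ?_
  have := L.add_mem (h1 x.1) (h2 x.2)
  simpa using this

/-- The branches of a countable set have pairwise disjoint tails. -/
theorem exists_disjoint_tails {node : X → ℕ → T}
    (hsep : ∀ b b', b ≠ b' → ∀ᶠ n in Filter.atTop, node b n ≠ node b' n)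
    {Y : Set X} (hY : Y.Countable) :
    ∃ m : X → ℕ, ∀ b ∈ Y, ∀ b' ∈ Y, ∀ n, m b ≤ n → m b' ≤ n → node b n = node b' n → b = b' := by
  obtain ⟨f, hf⟩ := Set.countable_iff_exists_injOn.1 hY
  -- In an enumeration of `Y`, the tail of `b` only has to avoid its finitely many predecessors.
  have hfin : ∀ b, {b' | b' ∈ Y ∧ f b' < f b}.Finite := fun b =>
    Set.Finite.of_injOn (t := Set.Iio (f b)) (fun b' hb' => hb'.2)
      (hf.mono fun b' hb' => hb'.1) (Set.finite_Iio _)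
  have hm : ∀ b, ∃ m, ∀ n, m ≤ n → ∀ b' ∈ {b' | b' ∈ Y ∧ f b' < f b}, node b n ≠ node b' n := by
    intro b
    rw [← Filter.eventually_atTop, Filter.eventually_all_finite (hfin b)]
    rintro b' ⟨-, hlt⟩
    exact hsep b b' fun h => hlt.ne (by rw [h])
  choose m hm using hm
  refine ⟨m, fun b hb b' hb' n hn hn' heq => ?_⟩
  rcases lt_trichotomy (f b) (f b') with h | h | h
  · exact absurd heq.symm (hm b' n hn' b ⟨hb, h⟩)
  · exact hf hb hb' h
  · exact absurd heq (hm b n hn b' ⟨hb', h⟩)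

theorem map_sub_smul_sub {Q : Type*} [AddCommGroup Q] [Module S Q] (π : Q →ₗ[S] Q) (r : S)
    (x y z : Q) : π (x - r • y - z) = π x - r • π y - π z := by
  rw [map_sub, map_sub, map_smul]

theorem exists_submodule_mem_iff_sub_mem {Q : Type*} [AddCommGroup Q] [Module S Q]
    (K : Submodule S Q) (π : Q →ₗ[S] Q) : ∃ L : Submodule S Q, ∀ x, x ∈ L ↔ π x - x ∈ K :=
  ⟨K.comap (π - LinearMap.id), fun _ => Iff.rfl⟩

/-- Changing the generators of a tree module modulo relations, one can satisfy exactly the relations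
of the branches of a countable set. -/
theorem exists_exact_generators {Q : Type*} [AddCommGroup Q] [Module S Q] (K : Submodule S Q)
    (a : ℕ → S) {node : X → ℕ → T} (hlev : ∀ b b' n n', node b n = node b' n' → n = n')
    (hsep : ∀ b b', b ≠ b' → ∀ᶠ n in Filter.atTop, node b n ≠ node b' n)
    (d : T → Q) (e : X → ℕ → Q) (he : ∀ b n, e b n - a n • e b (n + 1) - d (node b n) ∈ K)
    {Y : Set X} (hY : Y.Countable) :
    ∃ (D : T → Q) (V : X → ℕ → Q), (∀ t, D t - d t ∈ K) ∧ (∀ b n, V b n - e b n ∈ K) ∧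
      ∀ b ∈ Y, ∀ n, V b n - a n • V b (n + 1) = D (node b n) := by
  classical
  obtain ⟨m, hm⟩ := exists_disjoint_tails hsep hY
  -- A node on a tail is redefined by its relation; this is consistent because it lies on one tail
  -- only.
  have hD : ∀ t, ∃ q : Q, q - d t ∈ K ∧
      ∀ b ∈ Y, ∀ n, m b ≤ n → node b n = t → q = e b n - a n • e b (n + 1) := by
    intro t
    by_cases h : ∃ b ∈ Y, ∃ n, m b ≤ n ∧ node b n = t
    · obtain ⟨b, hb, n, hn, rfl⟩ := h
      refine ⟨_, he b n, fun b' hb' n' hn' h => ?_⟩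
      obtain rfl := hlev _ _ _ _ h
      obtain rfl := hm _ hb' _ hb _ hn' hn h
      rfl
    · exact ⟨d t, by simp, fun b hb n hn hbn => absurd ⟨b, hb, n, hn, hbn⟩ h⟩
  choose D hDK hD using hD
  -- Below the tail, only finitely many relations of `b` remain to be corrected.
  have hV : ∀ b, ∃ v : ℕ → Q, (∀ n, v n - e b n ∈ K) ∧
      (b ∈ Y → ∀ n, v n - a n • v (n + 1) = D (node b n)) := by
    intro b
    by_cases hb : b ∈ Y
    · obtain ⟨v, hv, hvK⟩ := exists_exact_solution K a (fun n => D (node b n)) (m b) (e b)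
        (fun n => by
          have := sub_mem (hDK (node b n)) (he b n)
          convert this using 1
          abel)
        (fun n hn => hD _ b hb n hn rfl)
      exact ⟨v, hvK, fun _ => hv⟩
    · exact ⟨e b, fun n => by simp, fun h => absurd h hb⟩
  choose V hVK hVD using hV
  exact ⟨D, V, hDK, hVK, hVD⟩

end Tree

theorem isPureMono_treeMap {S X T : Type u} [Ring S] (a : ℕ → S) {node : X → ℕ → T}
    (hlev : ∀ b b' n n', node b n = node b' n' → n = n')
    (hsep : ∀ b b', b ≠ b' → ∀ᶠ n in Filter.atTop, node b n ≠ node b' n) :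
    IsPureMono (S := S) (B := X →₀ ℕ →₀ S) (A := (T →₀ S) × (X →₀ ℕ →₀ S)) (Cardinal.aleph 1)
      (treeMap a node) := by
  refine .of_exists_endomorphism (treeMap_injective a node) fun s hs hcard => ?_
  have hcount : s.Countable := by
    rw [← Cardinal.le_aleph0_iff_set_countable, ← Order.lt_succ_iff, Cardinal.succ_aleph0]
    exact hcard
  have hs' : ∀ y ∈ s, ∃ c, treeMap a node c = y := fun y hy => hs hy
  choose! c hc using hs'
  -- Countably many relations involve only countably many branches.
  let Y : Set X := ⋃ y ∈ s, ((c y).support : Set X)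
  have hY : Y.Countable := hcount.biUnion fun y _ => (c y).support.countable_toSet
  obtain ⟨D, V, hD, hV, hDV⟩ := exists_exact_generators (LinearMap.range (treeMap a node)) a
    hlev hsep (nodeVec S X) (branchVec S T) (fun b n => ⟨_, treeMap_single a node b n⟩) hY
  let π : (T →₀ S) × (X →₀ ℕ →₀ S) →ₗ[S] (T →₀ S) × (X →₀ ℕ →₀ S) :=
    (Finsupp.linearCombination S D).coprod
      (Finsupp.lsum ℕ fun b => Finsupp.linearCombination S (V b))
  have hπe : ∀ b n, π (branchVec S T b n) = V b n := fun b n => by simp [π, branchVec]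
  have hπd : ∀ t, π (nodeVec S X t) = D t := fun t => by simp [π, nodeVec]
  obtain ⟨L, hL⟩ := exists_submodule_mem_iff_sub_mem (S := S) (Q := (T →₀ S) × (X →₀ ℕ →₀ S))
    (LinearMap.range (treeMap a node)) π
  have htop : L = ⊤ := by
    refine eq_top_of_nodeVec_mem_of_branchVec_mem (fun t => ?_) fun b n => ?_
    · rw [hL, hπd]
      exact hD t
    · rw [hL, hπe]
      exact hV b n
  refine ⟨π, fun x => (hL x).1 (htop.ge Submodule.mem_top), fun y hy => ?_⟩
  · rw [← hc y hy]
    have hb : ∀ b ∈ Y, π ∘ₗ treeMap a node ∘ₗ Finsupp.lsingle b = 0 := fun b hb => by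
      refine Finsupp.lhom_ext' fun n => LinearMap.ext_ring ?_
      change π (treeMap a node (Finsupp.single b (Finsupp.single n 1))) = 0
      rw [treeMap_single]
      refine (map_sub_smul_sub (S := S) (Q := (T →₀ S) × (X →₀ ℕ →₀ S)) π _ _ _ _).trans ?_
      rw [hπd, hπe, hπe, hDV b hb, sub_self]
    conv_lhs => rw [← Finsupp.sum_single (c y), Finsupp.sum, map_sum, map_sum]
    exact Finset.sum_eq_zero fun b hbs =>
      LinearMap.congr_fun (hb b (Set.mem_biUnion hy hbs)) (c y b)

/-! ### The counting argument -/

section Extension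

/-- If maps out of the relations of a tree module extend along `treeMap`, and there are fewer maps
from the nodes than sets of branches, then maps extend along `bassMap`. -/
theorem exists_extension_of_treeMap {S X T N : Type*} [Ring S] [AddCommGroup N] [Module S N]
    {a : ℕ → S} {node : X → ℕ → T}
    (hcard : ¬ ∃ δ : Set X → T → N, Function.Injective δ)
    (hext : ∀ h : (X →₀ ℕ →₀ S) →ₗ[S] N, ∃ g, g ∘ₗ treeMap a node = h)
    (h : (ℕ →₀ S) →ₗ[S] N) : ∃ g, g ∘ₗ bassMap a = h := by
  classical
  by_contra hcon
  choose G hG using fun Y : Set X => hext (Finsupp.lsum ℕ fun b => if b ∈ Y then h else 0)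
  have hG' : ∀ Y b n, G Y (branchVec S T b n - a n • branchVec S T b (n + 1)) -
      G Y (nodeVec S X (node b n)) = (if b ∈ Y then h else 0) (Finsupp.single n 1) := by
    intro Y b n
    rw [← map_sub, ← treeMap_single, ← LinearMap.comp_apply, hG]
    simp
  have key : ∀ Y Z : Set X, (∀ t, G Y (nodeVec S X t) = G Z (nodeVec S X t)) →
      ∀ b ∈ Y, b ∈ Z := by
    intro Y Z hYZ b hbY
    by_contra hbZ
    -- The node terms cancel in the difference, which therefore extends `h` on the copy of `bassMap`
    -- at `b`.
    refine hcon ⟨(G Y - G Z) ∘ₗ LinearMap.inr S _ _ ∘ₗ Finsupp.lsingle b, ?_⟩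
    ext n : 2
    have h1 := hG' Y b n
    have h2 := hG' Z b n
    rw [if_pos hbY] at h1
    rw [if_neg hbZ, LinearMap.zero_apply, ← hYZ, sub_eq_zero] at h2
    have h3 : (LinearMap.inr S (T →₀ S) (X →₀ ℕ →₀ S)) (Finsupp.single b (bassMap a
        (Finsupp.single n 1))) = branchVec S T b n - a n • branchVec S T b (n + 1) := by
      rw [bassMap_single]
      simp [branchVec]
    change (G Y - G Z) ((LinearMap.inr S (T →₀ S) (X →₀ ℕ →₀ S)) (Finsupp.single b (bassMap a
        (Finsupp.single n 1)))) = h (Finsupp.single n 1)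
    rw [h3, LinearMap.sub_apply, h2, h1]
  refine hcard ⟨fun Y t => G Y (nodeVec S X t), fun Y Z hYZ => Set.ext fun b => ⟨?_, ?_⟩⟩
  · exact key Y Z (congrFun hYZ) b
  · exact key Z Y (fun t => (congrFun hYZ t).symm) b

/-- There are arbitrarily large infinite sets `κ` with `2 ^ κ ≤ κ ^ ℵ₀`. -/
theorem exists_two_power_le_power_aleph0 (N : Type u) : ∃ κ : Type u, Infinite κ ∧
    Cardinal.mk N ≤ Cardinal.mk κ ∧
      (2 : Cardinal) ^ Cardinal.mk κ ≤ Cardinal.mk κ ^ Cardinal.aleph0 := by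
  -- Iterated power sets: a subset of the union is determined by its traces on the `K n`, and each
  -- trace is an element of `K (n + 1)`.
  let K : ℕ → Type u := fun n => Nat.rec (N ⊕ ULift.{u} ℕ) (fun _ α => Set α) n
  let i : N ⊕ ULift.{u} ℕ → Σ n, K n := fun x => ⟨0, x⟩
  have hi : Function.Injective i := fun x y h => by simpa [i] using h
  refine ⟨Σ n, K n, Infinite.of_injective (fun n : ℕ => i (.inr ⟨n⟩)) fun m n h => ?_,
    Cardinal.mk_le_of_injective (hi.comp Sum.inl_injective), ?_⟩
  · simpa using hi h
  · let F : Set (Σ n, K n) → ℕ → Σ n, K n := fun s n => ⟨n + 1, {x : K n | (⟨n, x⟩ : Σ n, K n) ∈ s}⟩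
    have hF : Function.Injective F := by
      intro s t h
      ext ⟨n, x⟩
      have h1 : ({x : K n | (⟨n, x⟩ : Σ n, K n) ∈ s} : Set (K n)) =
          {x : K n | (⟨n, x⟩ : Σ n, K n) ∈ t} := eq_of_heq (Sigma.mk.inj (congrFun h n)).2
      exact Set.ext_iff.1 h1 x
    have := Cardinal.mk_le_of_injective hF
    simpa using this

theorem IsPureInjective.homSurjective_bassMap {S N : Type u} [Ring S] [AddCommGroup N] [Module S N]
    (hN : IsPureInjective (Cardinal.aleph 1) S N) (a : ℕ → S) : HomSurjective (bassMap a) N := by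
  obtain ⟨κ, hκ, hNκ, hpow⟩ := exists_two_power_le_power_aleph0 N
  let node : (ℕ → κ) → ℕ → List κ := fun b n => (List.range n).map b
  have hlev : ∀ b b' n n', node b n = node b' n' → n = n' := fun b b' n n' h => by
    simpa [node] using congrArg List.length h
  have hsep : ∀ b b', b ≠ b' → ∀ᶠ n in Filter.atTop, node b n ≠ node b' n := by
    intro b b' hb
    obtain ⟨k, hk⟩ := Function.ne_iff.1 hb
    filter_upwards [Filter.eventually_gt_atTop k] with n hn h
    exact hk (List.map_inj_left.1 h k (List.mem_range.2 hn))
  refine exists_extension_of_treeMap (node := node) ?_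
    (hN _ _ _ (isPureMono_treeMap a hlev hsep))
  -- Such a `δ` would embed the power set of the branches into a set no larger than the set of
  -- branches.
  rintro ⟨δ, hδ⟩
  have h1 := Cardinal.mk_le_of_injective hδ
  have h2 : Cardinal.mk (List κ → N) ≤ Cardinal.mk (ℕ → κ) := by
    calc Cardinal.mk (List κ → N) = Cardinal.mk N ^ Cardinal.mk κ := by
          rw [← Cardinal.power_def, Cardinal.mk_list_eq_mk]
      _ ≤ Cardinal.mk κ ^ Cardinal.mk κ := Cardinal.power_le_power_right hNκ
      _ = 2 ^ Cardinal.mk κ := Cardinal.power_self_eq (Cardinal.aleph0_le_mk κ)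
      _ ≤ Cardinal.mk κ ^ Cardinal.aleph0 := hpow
      _ = Cardinal.mk (ℕ → κ) := by simp
  rw [Cardinal.mk_set] at h1
  exact (h1.trans h2).not_gt (Cardinal.cantor _)

end Extension

/-! ### Conclusion -/

theorem not_hasEnoughPureInjectives_of_homSurjective {κ : Cardinal.{u}} {S B A : Type u} [Ring S]
    [AddCommGroup B] [Module S B] [AddCommGroup A] [Module S A] {f : B →ₗ[S] A}
    (hf : ¬ IsPureMono κ f)
    (h : ∀ (N : Type u) [AddCommGroup N] [Module S N], IsPureInjective κ S N → HomSurjective f N) :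
    ¬ HasEnoughPureInjectives κ S := by
  intro hen
  obtain ⟨N, _, _, j, hN, hj⟩ := hen B
  obtain ⟨g, rfl⟩ := h N hN j
  exact hf hj.of_comp

theorem exists_not_isPureMono_bassMap {R : Type u} [Ring R] (hR : ¬ IsRightPerfect R) :
    ∃ a : ℕ → Rᵐᵒᵖ, ¬ IsPureMono (Cardinal.aleph 1) (bassMap a) := by
  by_contra! hcon
  refine hR (HasPrincipalLeftDCC.isRightPerfect fun x b hx => ?_)
  obtain ⟨ρ, hρ⟩ := (hcon fun n => .op (b n)).exists_retraction (isLTPresented_bassMap _)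
  obtain ⟨n, s, hs⟩ := exists_eq_mul_of_bassMap_retraction hρ (y := fun n => .op (x n))
    fun n => by rw [hx, MulOpposite.op_mul]
  exact ⟨n, s.unop, congrArg MulOpposite.unop hs⟩

theorem proposition1p4 (R : Type u) [Ring R] (hR : ¬ IsRightPerfect R) :
    ¬ HasEnoughPureInjectives (Cardinal.aleph 1) Rᵐᵒᵖ ∧
    ∃ (B A : Type u) (_ : AddCommGroup B) (_ : Module Rᵐᵒᵖ B) (_ : AddCommGroup A)
      (_ : Module Rᵐᵒᵖ A) (f : B →ₗ[Rᵐᵒᵖ] A),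
      IsPureMono Cardinal.aleph0 f ∧ ¬ IsPureMono (Cardinal.aleph 1) f ∧
      ∀ (N : Type u) [AddCommGroup N] [Module Rᵐᵒᵖ N],
        IsPureInjective (Cardinal.aleph 1) Rᵐᵒᵖ N → HomSurjective f N := by
  obtain ⟨a, ha⟩ := exists_not_isPureMono_bassMap hR
  have hsurj : ∀ (N : Type u) [AddCommGroup N] [Module Rᵐᵒᵖ N],
      IsPureInjective (Cardinal.aleph 1) Rᵐᵒᵖ N → HomSurjective (bassMap a) N :=
    fun N _ _ hN => hN.homSurjective_bassMap a
  exact ⟨not_hasEnoughPureInjectives_of_homSurjective ha hsurj, _, _, _, _, _, _, bassMap a,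
    isPureMono_bassMap a, ha, hsurj⟩
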